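/- Let $K$ be a compact Hausdorff space and let $d : K\times K\to[0,+\infty)$ be a metric on $K$ that is lower semicontinuous as a function on the topological product $K \times K$ (the topology generated by $d$ need not be the topology of $K$). Say that $K$ is *fragmented* by $d$ if for every nonempty $A\subset K$ and every $\varepsilon>0$ there is an open set $U\subset K$ with $A\cap U\neq\emptyset$ and $d\text{-}\mathrm{diam}(A\cap U)<\varepsilon$. Let $C(K)$ be the Banach space of real continuous functions on $K$ with the supremum norm; a linear subspace $X\subset C(K)$ is called *Lipschitz* if every $f\in X$ is Lipschitz with respect to $d$. Then the following statements are equivalent: (i) $K$ is not fragmented by $d$; (ii) $C(K)$ contains an isometric Lipschitz copy of $\ell_1$, that is, a Lipschitz subspace linearly isometric to $\ell_1$; (iii) $C(K)$ contains an isomorphic Lipschitz copy of $\ell_1$, that is, a Lipschitz subspace linearly homeomorphic to $\ell_1$. Here $\ell_1$ is the real Banach space of absolutely summable sequences with its usual norm. -/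

import Mathlib

open scoped ENNReal

/-- `d` is a (finite, real-valued) metric on the set `K`. It is kept as a plain function, since `K`
carries a topology of its own which is in general not the one generated by `d`. -/
structure IsMetricOn {K : Type*} (d : K → K → ℝ) : Prop where
  nonneg : ∀ x y, 0 ≤ d x y
  eq_zero_iff : ∀ x y, d x y = 0 ↔ x = y
  symm : ∀ x y, d x y = d y x
  triangle : ∀ x y z, d x z ≤ d x y + d y z

/-- The diameter of `A` with respect to `d`, with value `∞` when `A` is `d`-unbounded. -/
noncomputable def diamOf {K : Type*} (d : K → K → ℝ) (A : Set K) : ℝ≥0∞ :=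
  ⨆ x ∈ A, ⨆ y ∈ A, ENNReal.ofReal (d x y)

/-- `K` is fragmented by `d`: every nonempty subset of `K` has nonempty relatively open subsets of
arbitrarily small `d`-diameter. -/
def FragmentedBy (K : Type*) [TopologicalSpace K] (d : K → K → ℝ) : Prop :=
  ∀ A : Set K, A.Nonempty → ∀ ε : ℝ, 0 < ε →
    ∃ U : Set K, IsOpen U ∧ (A ∩ U).Nonempty ∧ diamOf d (A ∩ U) < ENNReal.ofReal ε

/-- `f` is a Lipschitz function with respect to `d`. -/
def IsLipschitzFor {K : Type*} (d : K → K → ℝ) (f : K → ℝ) : Prop :=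
  ∃ C : ℝ, ∀ s t, |f s - f t| ≤ C * d s t

/-- A linear subspace of `C(K)` is Lipschitz if all its elements are `d`-Lipschitz functions. -/
def IsLipschitzSubspace {K : Type*} [TopologicalSpace K] (d : K → K → ℝ)
    (X : Submodule ℝ C(K, ℝ)) : Prop :=
  ∀ f ∈ X, IsLipschitzFor d f

/-- `C(K)` (with the supremum norm) contains an isometric Lipschitz copy of `E`: a Lipschitz subspace
which is linearly isometric to `E`. -/
def ContainsIsometricLipschitzCopy (K : Type*) [TopologicalSpace K] [CompactSpace K]
    (d : K → K → ℝ) (E : Type*) [NormedAddCommGroup E] [NormedSpace ℝ E] : Prop :=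
  ∃ X : Submodule ℝ C(K, ℝ), IsLipschitzSubspace d X ∧ Nonempty (E ≃ₗᵢ[ℝ] X)

/-- `C(K)` (with the supremum norm) contains an isomorphic Lipschitz copy of `E`: a Lipschitz subspace
which is linearly homeomorphic to `E`. -/
def ContainsIsomorphicLipschitzCopy (K : Type*) [TopologicalSpace K] [CompactSpace K]
    (d : K → K → ℝ) (E : Type*) [NormedAddCommGroup E] [NormedSpace ℝ E] : Prop :=
  ∃ X : Submodule ℝ C(K, ℝ), IsLipschitzSubspace d X ∧ Nonempty (E ≃L[ℝ] X)

/-- The Banach space `ℓ₁` of absolutely summable real sequences. -/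
abbrev EllOne : Type := lp (fun _ : ℕ => ℝ) 1

/-!
If `K` is not fragmented, some nonempty `A` has only relatively open pieces of diameter more than
`ε`. Lower semicontinuity of `d` lets one split them repeatedly, which gives a Cantor scheme whose
branches at each level are `d`-separated. Interpolating dyadically between two closed `d`-separated
sets, as in Urysohn's lemma, produces a continuous function that is also `d`-Lipschitz. Thus there
are equi-Lipschitz functions with values in `[-1, 1]` realizing all patterns of signs, like the
Rademacher functions, and they span `ℓ₁` isometrically.

Conversely, let `T : ℓ₁ → C(K)` be an isomorphic embedding with Lipschitz range. By the uniform
boundedness principle the functions `T eₙ` are equi-Lipschitz. If `K` were fragmented, the image of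
`K` under `x ↦ (T eₙ x)ₙ` would be separable for the supremum distance, so that a subsequence
converges pointwise. Its consecutive differences are pointwise null, hence weakly null by dominated
convergence, and some of their convex combinations are small in norm. But a convex combination of
vectors `e_{σ(2k)} - e_{σ(2k+1)}` has norm `2` in `ℓ₁`.
-/

open Function Set Filter Topology
open scoped NNReal lp

section LevelFunction

variable {ι X : Type*} {q : ι → ℝ} {S : ι → Set X} {x : X}

/-- The function whose sublevel sets are prescribed, up to equality of levels, by a family of sets
`S i` carrying labels `q i`. If no `S i` contains `x`, or those that do have labels unbounded below,
the value is the junk value `0`. -/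
noncomputable def level (q : ι → ℝ) (S : ι → Set X) (x : X) : ℝ :=
  sInf (q '' {i | x ∈ S i})

/-- A family of labelled open sets to which Urysohn's construction applies: it covers the space,
each point avoids all sets of sufficiently low label, and the closure of a set is contained in all
sets of larger label. -/
structure IsUrysohnFamily [TopologicalSpace X] (q : ι → ℝ) (S : ι → Set X) : Prop where
  isOpen : ∀ i, IsOpen (S i)
  closure_subset : ∀ {i j}, q i < q j → closure (S i) ⊆ S j
  exists_mem : ∀ x, ∃ i, x ∈ S i
  bddBelow : ∀ x, BddBelow (q '' {i | x ∈ S i})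

namespace IsUrysohnFamily

variable [TopologicalSpace X] (h : IsUrysohnFamily q S)
include h

theorem level_le {i : ι} (hx : x ∈ S i) : level q S x ≤ q i :=
  csInf_le (h.bddBelow x) (mem_image_of_mem q hx)

theorem level_lt_iff {c : ℝ} : level q S x < c ↔ ∃ i, x ∈ S i ∧ q i < c := by
  rw [level, csInf_lt_iff (h.bddBelow x) (Set.Nonempty.image q (h.exists_mem x)),
    exists_mem_image]
  rfl

theorem mem_of_level_lt {i : ι} (hx : level q S x < q i) : x ∈ S i := by
  obtain ⟨j, hj, hji⟩ := h.level_lt_iff.1 hx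
  exact h.closure_subset hji (subset_closure hj)

theorem continuous_level (hq : DenseRange q) : Continuous (level q S) := by
  rw [continuous_iff_lower_upperSemicontinuous, lowerSemicontinuous_iff_isClosed_preimage,
    upperSemicontinuous_iff_isOpen_preimage]
  constructor
  · intro c
    have : level q S ⁻¹' Iic c = ⋂ i ∈ {i | c < q i}, closure (S i) := by
      ext x
      simp only [mem_preimage, mem_Iic, mem_iInter₂]
      refine ⟨fun hx i hi => subset_closure (h.mem_of_level_lt (hx.trans_lt hi)), fun hx => ?_⟩
      by_contra! hc
      obtain ⟨_, ⟨i, rfl⟩, hi⟩ := hq.exists_between hc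
      obtain ⟨_, ⟨j, rfl⟩, hj⟩ := hq.exists_between hi.2
      exact (h.level_le (h.closure_subset hj.1 (hx i hi.1))).not_gt hj.2
    rw [this]
    exact isClosed_biInter fun _ _ => isClosed_closure
  · intro c
    have : level q S ⁻¹' Iio c = ⋃ i ∈ {i | q i < c}, S i := by
      ext x
      simp [h.level_lt_iff, and_comm]
    rw [this]
    exact isOpen_biUnion fun i _ => h.isOpen i

end IsUrysohnFamily

end LevelFunction

section Urysohn

variable {K : Type*} {d : PseudoMetric K ℝ} {a b r : ℝ} {F G : Set K}

/-- All points of `F` have `d`-distance more than `r` to all points of `G`: the quantitative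
separation from which a Lipschitz Urysohn function is built. Unlike a bound on the infimal distance,
the strict pointwise inequality passes through lower semicontinuity of `d`. -/
def FarApart (d : K → K → ℝ) (r : ℝ) (F G : Set K) : Prop :=
  ∀ ⦃x⦄, x ∈ F → ∀ ⦃y⦄, y ∈ G → r < d x y

theorem FarApart.symm (h : FarApart d r F G) : FarApart d r G F :=
  fun _ hx _ hy => (h hy hx).trans_eq (d.symm _ _)

theorem FarApart.subset_of_compl (hr : 0 ≤ r) (h : FarApart d r F Gᶜ) : F ⊆ G := by
  intro x hx
  by_contra hxG
  exact (h hx hxG).not_ge ((d.refl x).trans_le hr)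

variable [TopologicalSpace K]

/-- A two-sided chain of open sets, the `d`-distance from each of them to the complement of the
next one being larger than `a`. -/
def IsFarChain (d : K → K → ℝ) (a : ℝ) (S : ℤ → Set K) : Prop :=
  ∀ k, IsOpen (S k) ∧ FarApart d a (closure (S k)) (S (k + 1))ᶜ

theorem IsFarChain.closure_subset {S : ℤ → Set K} (ha : 0 ≤ a) (h : IsFarChain d a S) {i j : ℤ}
    (hij : i < j) : closure (S i) ⊆ S j := by
  have hsucc : ∀ k, closure (S k) ⊆ S (k + 1) := fun k => (h k).2.subset_of_compl ha
  have hmono : Monotone S := monotone_int_of_le_succ fun k => subset_closure.trans (hsucc k)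
  exact (hsucc i).trans (hmono hij)

/-- The dyadic number `k / 2 ^ n` encoded by the pair `(n, k)`. -/
noncomputable def dyadic (i : ℕ × ℤ) : ℝ :=
  i.2 / 2 ^ i.1

theorem denseRange_dyadic : DenseRange dyadic := by
  refine dense_of_exists_between fun x y hxy => ?_
  obtain ⟨n, hn⟩ := pow_unbounded_of_one_lt (1 / (y - x)) one_lt_two
  have hp : (0 : ℝ) < 2 ^ n := by positivity
  have hgap : 1 < (y - x) * 2 ^ n := by rwa [div_lt_iff₀' (sub_pos.2 hxy)] at hn
  refine ⟨_, ⟨(n, ⌊x * 2 ^ n⌋ + 1), rfl⟩, (lt_div_iff₀ hp).2 ?_, (div_lt_iff₀ hp).2 ?_⟩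
  · simp
  · push_cast
    linarith [Int.floor_le (x * 2 ^ n)]

/-- A sequence of chains of open sets, each refining the previous one: `S n k` is the set with
dyadic label `k / 2 ^ n`. -/
structure IsDyadicChain (d : K → K → ℝ) (a : ℝ) (S : ℕ → ℤ → Set K) : Prop where
  isFarChain : ∀ n, IsFarChain d (a / 2 ^ n) (S n)
  refines : ∀ n k, S (n + 1) (2 * k) = S n k

namespace IsDyadicChain

variable {S : ℕ → ℤ → Set K} (h : IsDyadicChain d a S)
include h

theorem refines_add (n m : ℕ) (k : ℤ) : S (n + m) (2 ^ m * k) = S n k := by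
  induction m with
  | zero => simp
  | succ m ih => rw [← ih, ← h.refines (n + m), ← add_assoc, pow_succ', mul_assoc]

theorem closure_subset (ha : 0 ≤ a) {n m : ℕ} {k j : ℤ} (hkj : dyadic (n, k) < dyadic (m, j)) :
    closure (S n k) ⊆ S m j := by
  rw [← h.refines_add n m, ← h.refines_add m n, add_comm m n]
  refine (h.isFarChain _).closure_subset (by positivity) ?_
  rw [dyadic, dyadic, div_lt_div_iff₀ (by positivity) (by positivity)] at hkj
  rw [mul_comm, mul_comm _ j]
  exact_mod_cast hkj

theorem isUrysohnFamily (ha : 0 ≤ a) (hbot : S 0 (-1) = ∅) (htop : S 0 2 = univ) :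
    IsUrysohnFamily dyadic (uncurry S) where
  isOpen i := (h.isFarChain i.1 i.2).1
  closure_subset := h.closure_subset ha
  exists_mem x := ⟨(0, 2), by simp [htop]⟩
  bddBelow x := by
    refine ⟨-1, ?_⟩
    rintro _ ⟨⟨n, k⟩, hx, rfl⟩
    by_contra! hlt
    have hempty : closure (S n k) ⊆ S 0 (-1) := h.closure_subset ha (by simpa [dyadic] using hlt)
    exact (hbot ▸ hempty (subset_closure hx) : x ∈ (∅ : Set K))

theorem level_le_add (ha : 0 ≤ a) (hbot : S 0 (-1) = ∅) (htop : S 0 2 = univ) {n : ℕ} {x y : K}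
    (hxy : d x y ≤ a / 2 ^ n) :
    level dyadic (uncurry S) y ≤ level dyadic (uncurry S) x + 2 / 2 ^ n := by
  have hfam := h.isUrysohnFamily ha hbot htop
  set f := level dyadic (uncurry S)
  have hp : (0 : ℝ) < 2 ^ n := by positivity
  set k : ℤ := ⌊f x * 2 ^ n⌋
  have hx : x ∈ S n (k + 1) := by
    refine hfam.mem_of_level_lt (i := (n, k + 1)) ((lt_div_iff₀ hp).2 ?_)
    push_cast
    exact Int.lt_floor_add_one _
  have hy : y ∈ S n (k + 1 + 1) := by
    by_contra hy
    exact ((h.isFarChain n (k + 1)).2 (subset_closure hx) hy).not_ge hxy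
  calc f y ≤ ((k + 1 + 1 : ℤ) : ℝ) / 2 ^ n := hfam.level_le (i := (n, k + 1 + 1)) hy
    _ = k / 2 ^ n + 2 / 2 ^ n := by push_cast; ring
    _ ≤ f x + 2 / 2 ^ n := by
      gcongr
      exact (div_le_iff₀ hp).2 (Int.floor_le _)

end IsDyadicChain

theorem le_mul_of_forall_dyadic_scale {s t : ℝ} (ha : 0 < a) (ht : 0 ≤ t) (hs : s ≤ 1)
    (h : ∀ n : ℕ, t ≤ a / 2 ^ n → s ≤ 2 / 2 ^ n) : s ≤ 4 / a * t := by
  by_contra! hlt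
  have hs0 : 0 < s := lt_of_le_of_lt (by positivity) hlt
  obtain ⟨n, hn, hn'⟩ := exists_nat_pow_near ((one_le_div hs0).2 (hs.trans one_le_two))
    one_lt_two
  rw [le_div_iff₀ hs0] at hn
  rw [div_lt_iff₀ hs0] at hn'
  have hp : (0 : ℝ) < 2 ^ (n + 1) := by positivity
  refine (h (n + 1) ?_).not_gt ((div_lt_iff₀' hp).2 hn')
  rw [div_mul_eq_mul_div, div_lt_iff₀ ha] at hlt
  rw [le_div_iff₀ hp, pow_succ]
  nlinarith

variable [CompactSpace K] [T2Space K] (hlsc : LowerSemicontinuous fun p : K × K => d p.1 p.2)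
include hlsc

theorem isClosed_setOf_exists_mem_le (hF : IsClosed F) (r : ℝ) :
    IsClosed {y | ∃ x ∈ F, d x y ≤ r} := by
  have hclosed : IsClosed {p : K × K | p.1 ∈ F ∧ d p.1 p.2 ≤ r} :=
    (hF.preimage continuous_fst).inter (hlsc.isClosed_preimage r)
  convert (hclosed.isCompact.image continuous_snd).isClosed using 1
  ext y
  simp

theorem FarApart.exists_isOpen_between (hF : IsClosed F) (hG : IsClosed G)
    (h : FarApart d (a + b) F G) :
    ∃ V, IsOpen V ∧ FarApart d a F Vᶜ ∧ FarApart d b (closure V) G := by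
  have hdisj : Disjoint {y | ∃ x ∈ F, d x y ≤ a} {y | ∃ x ∈ G, d x y ≤ b} := by
    rw [Set.disjoint_left]
    rintro z ⟨x, hx, hxz⟩ ⟨y, hy, hyz⟩
    linarith [d.triangle x z y, d.symm z y, h hx hy]
  obtain ⟨V, hV, hFV, hVG⟩ := normal_exists_closure_subset
    (isClosed_setOf_exists_mem_le hlsc hF a)
    (isClosed_setOf_exists_mem_le hlsc hG b).isOpen_compl hdisj.subset_compl_right
  refine ⟨V, hV, fun x hx y hy => ?_, FarApart.symm fun x hx y hy => ?_⟩
  · by_contra! hxy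
    exact hy (hFV ⟨x, hx, hxy⟩)
  · by_contra! hxy
    exact hVG hy ⟨x, hx, hxy⟩

theorem IsFarChain.exists_refinement {S : ℤ → Set K} (h : IsFarChain d a S) :
    ∃ S', IsFarChain d (a / 2) S' ∧ ∀ k, S' (2 * k) = S k := by
  choose V hV hSV hVS using fun k => FarApart.exists_isOpen_between hlsc isClosed_closure
    (h (k + 1)).1.isClosed_compl ((add_halves a).symm ▸ (h k).2)
  refine ⟨fun k => if k % 2 = 0 then S (k / 2) else V (k / 2), fun k => ?_, fun k => by simp⟩
  rcases Int.even_or_odd' k with ⟨m, rfl | rfl⟩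
  · have hm : (2 * m + 1) / 2 = m := by omega
    simpa [hm] using ⟨(h m).1, hSV m⟩
  · have hm : (2 * m + 1) / 2 = m := by omega
    have hm' : 2 * m + 1 + 1 = 2 * (m + 1) := by ring
    simpa [hm, hm'] using ⟨hV m, hVS m⟩

theorem IsFarChain.exists_isDyadicChain {S₀ : ℤ → Set K} (h : IsFarChain d a S₀) :
    ∃ S, S 0 = S₀ ∧ IsDyadicChain d a S := by
  choose! R hR hR2 using fun (r : ℝ) (T : ℤ → Set K) (hT : IsFarChain d r T) =>
    hT.exists_refinement hlsc
  let S : ℕ → ℤ → Set K := Nat.rec S₀ fun n T => R (a / 2 ^ n) T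
  have hS : ∀ n, IsFarChain d (a / 2 ^ n) (S n) := by
    intro n
    induction n with
    | zero => simpa [S] using h
    | succ n ih => simpa only [div_div, ← pow_succ] using hR _ _ ih
  exact ⟨S, rfl, hS, fun n => hR2 _ _ (hS n)⟩

theorem FarApart.exists_isDyadicChain (hF : IsClosed F) (hG : IsClosed G)
    (h : FarApart d a F G) :
    ∃ S, IsDyadicChain d a S ∧ S 0 (-1) = ∅ ∧ F ⊆ S 0 0 ∧ S 0 1 = Gᶜ ∧ S 0 2 = univ := by
  obtain ⟨V, hV, hFV, hVG⟩ := FarApart.exists_isOpen_between hlsc hF hG ((zero_add a).symm ▸ h)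
  let S₀ : ℤ → Set K := fun k => if k < 0 then ∅ else if k = 0 then V else if k = 1 then Gᶜ
    else univ
  have hS₀ : IsFarChain d a S₀ := by
    intro k
    rcases lt_trichotomy k 0 with hk | rfl | hk
    · simp [S₀, hk, FarApart]
    · simpa [S₀] using ⟨hV, hVG⟩
    · have hk' : S₀ (k + 1) = univ := by grind
      refine ⟨?_, by simp [hk', FarApart]⟩
      rcases eq_or_ne k 1 with rfl | hk1
      · simpa [S₀] using hG
      · simp [S₀, hk.not_gt, hk.ne', hk1]
  obtain ⟨S, hS0, hS⟩ := hS₀.exists_isDyadicChain hlsc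
  exact ⟨S, hS, by simp [hS0, S₀], by simpa [hS0, S₀] using hFV.subset_of_compl le_rfl,
    by simp [hS0, S₀], by simp [hS0, S₀]⟩

theorem FarApart.exists_continuous_lipschitz (hF : IsClosed F) (hG : IsClosed G) (ha : 0 < a)
    (h : FarApart d a F G) :
    ∃ f : C(K, ℝ), (∀ x, f x ∈ Icc 0 1) ∧ EqOn f 0 F ∧ EqOn f 1 G ∧
      ∀ x y, |f x - f y| ≤ 4 / a * d x y := by
  obtain ⟨S, hS, hbot, hFS, hSG, htop⟩ := h.exists_isDyadicChain hlsc hF hG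
  have hfam := hS.isUrysohnFamily ha.le hbot htop
  set g := level dyadic (uncurry S)
  have hg : Continuous g := hfam.continuous_level denseRange_dyadic
  let f : K → ℝ := fun x => projIcc 0 1 zero_le_one (g x)
  have hf : ∀ x, f x ∈ Icc 0 1 := fun x => (projIcc 0 1 zero_le_one (g x)).2
  refine ⟨⟨f, continuous_subtype_val.comp (continuous_projIcc.comp hg)⟩, hf, fun x hx => ?_,
    fun x hx => ?_, fun x y => ?_⟩
  · have hgx : g x ≤ 0 := by simpa [dyadic] using hfam.level_le (i := (0, 0)) (hFS hx)
    simp [f, projIcc_of_le_left _ hgx]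
  · have hgx : 1 ≤ g x := by
      by_contra! hlt
      have hx' : x ∈ S 0 1 := hfam.mem_of_level_lt (i := (0, 1)) (by simpa [dyadic] using hlt)
      exact (hSG ▸ hx') hx
    simp [f, projIcc_of_right_le _ hgx]
  · refine le_mul_of_forall_dyadic_scale ha (d.nonneg x y)
      (by simpa using abs_sub_le_of_le_of_le (hf x).1 (hf x).2 (hf y).1 (hf y).2)
      fun n hxy => (abs_projIcc_sub_projIcc zero_le_one).trans (abs_sub_le_iff.2 ⟨?_, ?_⟩)
    · linarith [hS.level_le_add ha.le hbot htop (d.symm x y ▸ hxy)]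
    · linarith [hS.level_le_add ha.le hbot htop hxy]

end Urysohn

section EllOneLift

variable {ι E : Type*} [NormedAddCommGroup E] [NormedSpace ℝ E]

theorem norm_smul_le_abs {v : E} (hv : ‖v‖ ≤ 1) (c : ℝ) : ‖c • v‖ ≤ |c| := by
  simpa [norm_smul] using mul_le_of_le_one_right (abs_nonneg c) hv

theorem hasSum_abs_ellOne (a : ℓ¹(ι, ℝ)) : HasSum (fun i => |a i|) ‖a‖ := by
  simpa using lp.hasSum_norm (p := 1) (by simp) a

variable [CompleteSpace E]

/-- The operator `a ↦ ∑ aᵢ vᵢ` on `ℓ¹` given by a family `v` in the unit ball of `E`. -/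
noncomputable def ellOneLift (v : ι → E) (hv : ∀ i, ‖v i‖ ≤ 1) : ℓ¹(ι, ℝ) →L[ℝ] E :=
  lp.tsumCLM ℝ ι E ∘L lp.mapCLM 1 (fun i => ContinuousLinearMap.toSpanSingleton ℝ (v i))
    zero_le_one fun i => by simpa using hv i

variable {v : ι → E} (hv : ∀ i, ‖v i‖ ≤ 1)

theorem hasSum_ellOneLift (a : ℓ¹(ι, ℝ)) : HasSum (fun i => a i • v i) (ellOneLift v hv a) :=
  (Summable.of_norm_bounded (hasSum_abs_ellOne a).summable fun i =>
    norm_smul_le_abs (hv i) (a i)).hasSum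

theorem norm_ellOneLift_le (a : ℓ¹(ι, ℝ)) : ‖ellOneLift v hv a‖ ≤ ‖a‖ :=
  (hasSum_ellOneLift hv a).norm_le_of_bounded (hasSum_abs_ellOne a) fun i =>
    norm_smul_le_abs (hv i) (a i)

theorem ellOneLift_single [DecidableEq ι] (i : ι) :
    ellOneLift v hv (lp.single 1 i (1 : ℝ)) = v i := by
  refine (hasSum_ellOneLift hv _).unique ?_
  convert hasSum_single (f := fun j => (Pi.single i 1 : ι → ℝ) j • v j) i fun j hj => ?_
    using 1 <;> simp [*]

end EllOneLift

section Signs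

variable {ι K : Type*}

/-- Every pattern of signs is attained by the functions `f i` at some point: the `f i` behave like
the Rademacher functions. -/
def RealizesSigns (f : ι → K → ℝ) : Prop :=
  ∀ θ : ι → Bool, ∃ x, ∀ i, f i x = if θ i then 1 else -1

variable [TopologicalSpace K] [CompactSpace K] {f : ι → C(K, ℝ)} (hf : ∀ i, ‖f i‖ ≤ 1)
include hf

theorem hasSum_ellOneLift_apply (a : ℓ¹(ι, ℝ)) (x : K) :
    HasSum (fun i => a i * f i x) (ellOneLift f hf a x) :=
  (hasSum_ellOneLift hf a).mapL (ContinuousMap.evalCLM ℝ x)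

theorem RealizesSigns.norm_ellOneLift (h : RealizesSigns fun i => f i) (a : ℓ¹(ι, ℝ)) :
    ‖ellOneLift f hf a‖ = ‖a‖ := by
  refine (norm_ellOneLift_le hf a).antisymm ?_
  obtain ⟨x, hx⟩ := h fun i => decide (0 ≤ a i)
  have hax : ellOneLift f hf a x = ‖a‖ := by
    refine (hasSum_ellOneLift_apply hf a x).unique ?_
    convert hasSum_abs_ellOne a using 2 with i
    rcases le_or_gt 0 (a i) with hi | hi
    · simp [hx, hi, abs_of_nonneg hi]
    · simp [hx, hi.not_ge, abs_of_neg hi]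
  calc ‖a‖ = ellOneLift f hf a x := hax.symm
    _ ≤ ‖ellOneLift f hf a‖ := (ellOneLift f hf a).apply_le_norm x

theorem isLipschitzFor_ellOneLift {d : K → K → ℝ} {C : ℝ}
    (hlip : ∀ i x y, |f i x - f i y| ≤ C * d x y) (a : ℓ¹(ι, ℝ)) :
    IsLipschitzFor d (ellOneLift f hf a) := by
  refine ⟨‖a‖ * C, fun x y => ?_⟩
  rw [mul_assoc]
  refine ((hasSum_ellOneLift_apply hf a x).sub
    (hasSum_ellOneLift_apply hf a y)).norm_le_of_bounded
    ((hasSum_abs_ellOne a).mul_right (C * d x y)) fun i => ?_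
  rw [← mul_sub, norm_mul]
  exact mul_le_mul_of_nonneg_left (hlip i x y) (abs_nonneg _)

theorem RealizesSigns.containsIsometricLipschitzCopy (h : RealizesSigns fun i => f i)
    {d : K → K → ℝ} {C : ℝ} (hlip : ∀ i x y, |f i x - f i y| ≤ C * d x y) :
    ContainsIsometricLipschitzCopy K d ℓ¹(ι, ℝ) := by
  let T : ℓ¹(ι, ℝ) →ₗᵢ[ℝ] C(K, ℝ) := ⟨(ellOneLift f hf).toLinearMap, h.norm_ellOneLift hf⟩
  refine ⟨LinearMap.range T.toLinearMap, ?_, ⟨T.equivRange⟩⟩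
  rintro _ ⟨a, rfl⟩
  exact isLipschitzFor_ellOneLift hf hlip a

end Signs

section NotFragmented

theorem fragmentedBy_iff {K : Type*} [TopologicalSpace K] {d : K → K → ℝ} :
    FragmentedBy K d ↔ ∀ A : Set K, A.Nonempty → ∀ ε, 0 < ε →
      ∃ U, IsOpen U ∧ (A ∩ U).Nonempty ∧ ∀ x ∈ A ∩ U, ∀ y ∈ A ∩ U, d x y ≤ ε := by
  refine forall₂_congr fun A _ => ⟨fun h ε hε => ?_, fun h ε hε => ?_⟩
  · obtain ⟨U, hU, hAU, hdiam⟩ := h ε hε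
    refine ⟨U, hU, hAU, fun x hx y hy => ?_⟩
    have hle : ENNReal.ofReal (d x y) ≤ diamOf d (A ∩ U) :=
      le_iSup₂_of_le x hx (le_iSup₂_of_le y hy le_rfl)
    exact ((ENNReal.ofReal_lt_ofReal_iff hε).1 (hle.trans_lt hdiam)).le
  · obtain ⟨U, hU, hAU, hle⟩ := h (ε / 2) (half_pos hε)
    refine ⟨U, hU, hAU, lt_of_le_of_lt ?_
      ((ENNReal.ofReal_lt_ofReal_iff hε).2 (half_lt_self hε))⟩
    exact iSup₂_le fun x hx => iSup₂_le fun y hy => ENNReal.ofReal_le_ofReal (hle x hx y hy)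

theorem FarApart.of_closureAntitone {β K : Type*} [TopologicalSpace K] {d : K → K → ℝ} {a : ℝ}
    {V : List β → Set K} (hV : CantorScheme.ClosureAntitone V)
    (hsep : ∀ l, Pairwise fun b c => FarApart d a (closure (V (b :: l))) (closure (V (c :: l))))
    {l m : List β} (hlen : l.length = m.length) (hne : l ≠ m) :
    FarApart d a (closure (V l)) (closure (V m)) := by
  induction l generalizing m with
  | nil => exact absurd (List.eq_nil_of_length_eq_zero hlen.symm).symm hne
  | cons b l ih =>
    obtain _ | ⟨c, m⟩ := m
    · simp at hlen
    by_cases hlm : l = m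
    · subst hlm
      exact hsep l (by simpa using hne)
    · intro x hx y hy
      exact ih (by simpa using hlen) hlm (subset_closure (hV l b hx)) (subset_closure (hV m c hy))

theorem exists_forall_mem_closure_res {β K : Type*} [TopologicalSpace K] [CompactSpace K]
    {V : List β → Set K} (hV : CantorScheme.ClosureAntitone V) (hne : ∀ l, (V l).Nonempty)
    (θ : ℕ → β) : ∃ x, ∀ n, x ∈ closure (V (PiNat.res θ n)) := by
  obtain ⟨x, hx⟩ := IsCompact.nonempty_iInter_of_sequence_nonempty_isCompact_isClosed
    (fun n => closure (V (PiNat.res θ n))) (fun n => (hV _ (θ n)).trans subset_closure)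
    (fun n => (hne _).closure) isClosed_closure.isCompact fun n => isClosed_closure
  exact ⟨x, mem_iInter.1 hx⟩

variable {K : Type*} [TopologicalSpace K] {d : PseudoMetric K ℝ} {A U F G : Set K} {a : ℝ}

theorem exists_isOpen_farApart_closure [RegularSpace K]
    (hlsc : LowerSemicontinuous fun p : K × K => d p.1 p.2) (hU : IsOpen U) {x y : K}
    (hx : x ∈ U) (hy : y ∈ U) (hxy : a < d x y) :
    ∃ V W, (IsOpen V ∧ x ∈ V ∧ closure V ⊆ U) ∧ (IsOpen W ∧ y ∈ W ∧ closure W ⊆ U) ∧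
      FarApart d a (closure V) (closure W) := by
  have hnhds : {p : K × K | a < d p.1 p.2} ∈ 𝓝 (x, y) := hlsc (x, y) a hxy
  obtain ⟨P, hP, Q, hQ, hPQ⟩ := mem_nhds_prod_iff.1 hnhds
  obtain ⟨V, ⟨hxV, hV⟩, hVP⟩ :=
    (hasBasis_opens_closure x).mem_iff.1 (inter_mem (hU.mem_nhds hx) hP)
  obtain ⟨W, ⟨hyW, hW⟩, hWQ⟩ :=
    (hasBasis_opens_closure y).mem_iff.1 (inter_mem (hU.mem_nhds hy) hQ)
  exact ⟨V, W, ⟨hV, hxV, fun z hz => (hVP hz).1⟩, ⟨hW, hyW, fun z hz => (hWQ hz).1⟩,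
    fun u hu v hv => hPQ (mk_mem_prod (hVP hu).2 (hWQ hv).2)⟩

theorem exists_farApart_cantorScheme [RegularSpace K]
    (hlsc : LowerSemicontinuous fun p : K × K => d p.1 p.2) (hne : A.Nonempty)
    (hA : ∀ U, IsOpen U → (A ∩ U).Nonempty → ∃ x ∈ A ∩ U, ∃ y ∈ A ∩ U, a < d x y) :
    ∃ V : List Bool → Set K, CantorScheme.ClosureAntitone V ∧ (∀ l, (V l).Nonempty) ∧
      ∀ l, Pairwise fun b c => FarApart d a (closure (V (b :: l))) (closure (V (c :: l))) := by
  have hsplit : ∀ U, IsOpen U ∧ (A ∩ U).Nonempty → ∃ V : Bool → Set K,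
      (∀ b, IsOpen (V b) ∧ (A ∩ V b).Nonempty) ∧ (∀ b, closure (V b) ⊆ U) ∧
      Pairwise fun b c => FarApart d a (closure (V b)) (closure (V c)) := by
    rintro U ⟨hU, hAU⟩
    obtain ⟨x, hx, y, hy, hxy⟩ := hA U hU hAU
    obtain ⟨V, W, ⟨hV, hxV, hVU⟩, ⟨hW, hyW, hWU⟩, hVW⟩ :=
      exists_isOpen_farApart_closure hlsc hU hx.2 hy.2 hxy
    refine ⟨fun b => cond b W V, ?_, ?_, ?_⟩
    · exact Bool.forall_bool.2 ⟨⟨hV, x, hx.1, hxV⟩, ⟨hW, y, hy.1, hyW⟩⟩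
    · exact Bool.forall_bool.2 ⟨hVU, hWU⟩
    · rintro (_ | _) (_ | _) hbc
      exacts [absurd rfl hbc, hVW, hVW.symm, absurd rfl hbc]
  choose! W hW hWU hWsep using hsplit
  let V : List Bool → Set K := List.rec univ fun b _ U => W U b
  have hV : ∀ l, IsOpen (V l) ∧ (A ∩ V l).Nonempty := by
    intro l
    induction l with
    | nil => exact ⟨isOpen_univ, by simpa [V] using hne⟩
    | cons b l ih => exact hW _ ih b
  exact ⟨V, fun l b => hWU _ (hV l) b, fun l => (hV l).2.mono inter_subset_right,
    fun l => hWsep _ (hV l)⟩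

variable [CompactSpace K] [T2Space K] (hlsc : LowerSemicontinuous fun p : K × K => d p.1 p.2)
include hlsc

theorem FarApart.exists_continuous_lipschitz_signs (hF : IsClosed F) (hG : IsClosed G)
    (ha : 0 < a) (h : FarApart d a F G) :
    ∃ f : C(K, ℝ), ‖f‖ ≤ 1 ∧ EqOn f (-1) F ∧ EqOn f 1 G ∧
      ∀ x y, |f x - f y| ≤ 8 / a * d x y := by
  obtain ⟨g, hg, hgF, hgG, hlip⟩ := h.exists_continuous_lipschitz hlsc hF hG ha
  refine ⟨(2 : ℝ) • g - 1, ?_, fun x hx => ?_, fun x hx => ?_, fun x y => ?_⟩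
  · refine (ContinuousMap.norm_le _ zero_le_one).2 fun x => abs_le.2 ?_
    simp only [ContinuousMap.sub_apply, ContinuousMap.smul_apply, ContinuousMap.one_apply,
      smul_eq_mul]
    constructor <;> linarith [(hg x).1, (hg x).2]
  · simp [hgF hx]
  · norm_num [hgG hx]
  · calc |((2 : ℝ) • g - 1) x - ((2 : ℝ) • g - 1) y| = 2 * |g x - g y| := by
          rw [← abs_two (α := ℝ), ← abs_mul]
          simp [mul_sub]
      _ ≤ 2 * (4 / a * d x y) := by gcongr; exact hlip x y
      _ = 8 / a * d x y := by ring

theorem exists_lipschitz_realizesSigns (h : ¬ FragmentedBy K d) :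
    ∃ (f : ℕ → C(K, ℝ)) (C : ℝ), (∀ n, ‖f n‖ ≤ 1) ∧ (RealizesSigns fun n => f n) ∧
      ∀ n x y, |f n x - f n y| ≤ C * d x y := by
  rw [fragmentedBy_iff] at h
  push Not at h
  obtain ⟨A, hA, ε, hε, hsep⟩ := h
  obtain ⟨V, hV, hVne, hVsep⟩ := exists_farApart_cantorScheme hlsc hA hsep
  let F : Bool → ℕ → Set K := fun b n => ⋃ l ∈ {l : List Bool | l.length = n}, closure (V (b :: l))
  have hF : ∀ b n, IsClosed (F b n) := fun b n =>
    (List.finite_length_eq Bool n).isClosed_biUnion fun _ _ => isClosed_closure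
  have hFF : ∀ n, FarApart d ε (F false n) (F true n) := by
    intro n x hx y hy
    obtain ⟨l, hl, hx⟩ := mem_iUnion₂.1 hx
    obtain ⟨m, hm, hy⟩ := mem_iUnion₂.1 hy
    refine FarApart.of_closureAntitone hV hVsep ?_ ?_ hx hy
    · exact congrArg Nat.succ (Eq.trans hl hm.symm)
    · simp
  choose f hf hfalse htrue hlip using fun n =>
    (hFF n).exists_continuous_lipschitz_signs hlsc (hF false n) (hF true n) hε
  refine ⟨f, 8 / ε, hf, fun θ => ?_, hlip⟩
  obtain ⟨x, hx⟩ := exists_forall_mem_closure_res hV hVne θ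
  refine ⟨x, fun n => ?_⟩
  have hxF : x ∈ F (θ n) n := mem_biUnion (PiNat.res_length θ n) (hx (n + 1))
  cases hθ : θ n
  · simpa using hfalse n (hθ ▸ hxF)
  · simpa using htrue n (hθ ▸ hxF)

theorem containsIsometricLipschitzCopy_of_not_fragmentedBy (h : ¬ FragmentedBy K d) :
    ContainsIsometricLipschitzCopy K d ℓ¹(ℕ, ℝ) := by
  obtain ⟨f, C, hf, hsigns, hlip⟩ := exists_lipschitz_realizesSigns hlsc h
  exact hsigns.containsIsometricLipschitzCopy hf hlip

end NotFragmented

theorem exists_norm_sub_le_of_pointwise_lipschitz {X E F : Type*} [NormedAddCommGroup E]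
    [NormedSpace ℝ E] [CompleteSpace E] [NormedAddCommGroup F] [NormedSpace ℝ F]
    (d : PseudoMetric X ℝ) (φ : X → E →L[ℝ] F)
    (h : ∀ a, ∃ C, ∀ x y, ‖φ x a - φ y a‖ ≤ C * d x y) :
    ∃ C, ∀ x y, ‖φ x - φ y‖ ≤ C * d x y := by
  let g : X × X → E →L[ℝ] F := fun p => (d p.1 p.2)⁻¹ • (φ p.1 - φ p.2)
  have hg : ∀ p, ‖g p‖ = (d p.1 p.2)⁻¹ * ‖φ p.1 - φ p.2‖ := fun p => by
    rw [norm_smul, norm_inv, Real.norm_of_nonneg (d.nonneg _ _)]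
  obtain ⟨C, hC⟩ := banach_steinhaus (g := g) fun a => by
    obtain ⟨C, hC⟩ := h a
    refine ⟨|C|, fun p => ?_⟩
    rw [smul_apply, norm_smul, norm_inv, Real.norm_of_nonneg (d.nonneg _ _)]
    refine inv_mul_le_of_le_mul₀ (d.nonneg _ _) (abs_nonneg C) ((hC _ _).trans ?_)
    rw [mul_comm]
    exact mul_le_mul_of_nonneg_left (le_abs_self C) (d.nonneg _ _)
  refine ⟨C, fun x y => ?_⟩
  rcases (d.nonneg x y).eq_or_lt with hxy | hxy
  · have hφ : φ x = φ y := by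
      ext a
      obtain ⟨C, hC⟩ := h a
      exact sub_eq_zero.1 (norm_le_zero_iff.1 (by simpa [← hxy] using hC x y))
    simp [hφ, ← hxy]
  · rw [mul_comm, ← inv_mul_le_iff₀ hxy]
    exact (hg (x, y)).symm.trans_le (hC (x, y))

section CountableNet

theorem exists_minimal_isClosed_subset_image {X Y : Type*} [TopologicalSpace X] [CompactSpace X]
    [TopologicalSpace Y] [T1Space Y] {f : X → Y} (hf : Continuous f) {B : Set Y}
    (hB : B ⊆ range f) : ∃ E, Minimal (fun E => IsClosed E ∧ B ⊆ f '' E) E := by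
  have hlower : ∀ c ⊆ {E | IsClosed E ∧ B ⊆ f '' E}, IsChain (· ⊆ ·) c → c.Nonempty →
      B ⊆ f '' ⋂₀ c := by
    intro c hc hchain hne y hy
    have : Nonempty c := hne.to_subtype
    have hdir : Directed (· ⊇ ·) ((↑) : c → Set X) :=
      directedOn_iff_directed.1 (IsChain.directedOn hchain.symm)
    have hclosed : ∀ s : c, IsClosed ((s : Set X) ∩ f ⁻¹' {y}) := fun s =>
      (hc s.2).1.inter (isClosed_singleton.preimage hf)
    obtain ⟨x, hx⟩ := IsCompact.nonempty_iInter_of_directed_nonempty_isCompact_isClosed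
      (fun s : c => (s : Set X) ∩ f ⁻¹' {y})
      (hdir.mono_comp (· ⊇ ·) (g := (· ∩ f ⁻¹' {y})) fun s t hst =>
        inter_subset_inter_left _ hst)
      (fun s => (hc s.2).2 hy) (fun s => (hclosed s).isCompact) hclosed
    rw [mem_iInter] at hx
    exact ⟨x, fun s hs => (hx ⟨s, hs⟩).1, (hx ⟨_, hne.some_mem⟩).2⟩
  obtain ⟨E, -, hE⟩ := zorn_superset_nonempty {E | IsClosed E ∧ B ⊆ f '' E}
    (fun c hc hchain hne => ⟨⋂₀ c, ⟨isClosed_sInter fun s hs => (hc hs).1,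
      hlower c hc hchain hne⟩, fun s => sInter_subset_of_mem⟩)
    univ ⟨isClosed_univ, by rwa [image_univ]⟩
  exact ⟨E, hE⟩

theorem hereditarilyLindelof_induction_on {Y : Type*} [TopologicalSpace Y]
    [HereditarilyLindelofSpace Y] {p : Set Y → Prop} (hmono : ∀ ⦃s t⦄, s ⊆ t → p t → p s)
    (hunion : ∀ S : Set (Set Y), S.Countable → (∀ s ∈ S, p s) → p (⋃₀ S)) {s : Set Y}
    (h : ∀ B ⊆ s, B.Nonempty → ∃ V, IsOpen V ∧ (B ∩ V).Nonempty ∧ p (B ∩ V)) : p s := by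
  set G := ⋃₀ {V | IsOpen V ∧ p (s ∩ V)}
  have hsG : p (s ∩ G) := by
    refine (HereditarilyLindelofSpace.isLindelof (s ∩ G)).induction_on hmono hunion ?_
    rintro x ⟨-, V, ⟨hV, hpV⟩, hxV⟩
    refine ⟨(s ∩ G) ∩ V, inter_mem_nhdsWithin _ (hV.mem_nhds hxV), hmono ?_ hpV⟩
    exact inter_subset_inter_left V inter_subset_left
  suffices hs : s \ G = ∅ from hmono (subset_inter subset_rfl (sdiff_eq_empty.1 hs)) hsG
  by_contra hne
  obtain ⟨V, hV, ⟨x, ⟨-, hxG⟩, hxV⟩, hpV⟩ := h (s \ G) sdiff_subset (nonempty_iff_ne_empty.2 hne)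
  refine hxG ⟨V, ⟨hV, ?_⟩, hxV⟩
  refine hmono ?_ (hunion {s ∩ G, (s \ G) ∩ V} (by simp) (by simp [hsG, hpV]))
  grind

theorem FragmentedBy.exists_isOpen_forall_exists_le {K Y : Type*} [TopologicalSpace K]
    [CompactSpace K] [TopologicalSpace Y] [T2Space Y] {d : K → K → ℝ} (h : FragmentedBy K d)
    {φ : K → Y} (hφ : Continuous φ) {B : Set Y} (hB : B ⊆ range φ) (hne : B.Nonempty) {ε : ℝ}
    (hε : 0 < ε) :
    ∃ V, IsOpen V ∧ (B ∩ V).Nonempty ∧ ∃ z, ∀ y ∈ B ∩ V, ∃ x, φ x = y ∧ d x z ≤ ε := by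
  obtain ⟨E, ⟨hE, hBE⟩, hmin⟩ := exists_minimal_isClosed_subset_image hφ hB
  obtain ⟨U, hU, ⟨z, hz⟩, hdiam⟩ := fragmentedBy_iff.1 h E (hne.mono hBE).of_image ε hε
  have hEU : IsClosed (E \ U) := hE.sdiff hU
  -- The points of `B` lost when `U` is removed from `E` are images of points of `E ∩ U` only.
  have hnot : ¬ B ⊆ φ '' (E \ U) := fun hsub => (hmin ⟨hEU, hsub⟩ sdiff_subset hz.1).2 hz.2
  refine ⟨(φ '' (E \ U))ᶜ, (hEU.isCompact.image hφ).isClosed.isOpen_compl,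
    not_subset.1 hnot, z, fun y hy => ?_⟩
  obtain ⟨x, hx, rfl⟩ := hBE hy.1
  have hxU : x ∈ U := by
    by_contra hxU
    exact hy.2 ⟨x, ⟨hx, hxU⟩, rfl⟩
  exact ⟨x, rfl, hdiam x ⟨hx, hxU⟩ z hz⟩

theorem FragmentedBy.exists_countable_net {K ι E : Type*} [TopologicalSpace K] [CompactSpace K]
    [Countable ι] [MetricSpace E] [SecondCountableTopology E] {d : PseudoMetric K ℝ}
    (h : FragmentedBy K d) {f : ι → K → E} (hf : ∀ i, Continuous (f i)) {C : ℝ}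
    (hlip : ∀ i x y, dist (f i x) (f i y) ≤ C * d x y) {ε : ℝ} (hε : 0 < ε) :
    ∃ D : Set K, D.Countable ∧ ∀ x, ∃ y ∈ D, ∀ i, dist (f i x) (f i y) ≤ ε := by
  let φ : K → ι → E := fun x i => f i x
  let p : Set (ι → E) → Prop := fun s =>
    ∃ D : Set K, D.Countable ∧ ∀ x, φ x ∈ s → ∃ y ∈ D, ∀ i, dist (f i x) (f i y) ≤ ε
  suffices hp : p (range φ) by simpa [p] using hp
  refine hereditarilyLindelof_induction_on (p := p) ?_ ?_ fun B hB hne => ?_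
  · rintro s t hst ⟨D, hD, hDt⟩
    exact ⟨D, hD, fun x hx => hDt x (hst hx)⟩
  · intro S hS hpS
    choose! D hD hDs using hpS
    refine ⟨⋃ s ∈ S, D s, hS.biUnion hD, fun x ⟨s, hs, hx⟩ => ?_⟩
    obtain ⟨y, hy, hxy⟩ := hDs s hs x hx
    exact ⟨y, mem_biUnion hs hy, hxy⟩
  · have hC : 0 < |C| + 1 := by positivity
    obtain ⟨V, hV, hBV, z, hz⟩ := h.exists_isOpen_forall_exists_le (φ := φ)
      (continuous_pi hf) hB hne (div_pos hε hC)
    refine ⟨V, hV, hBV, {z}, countable_singleton z, fun x hx => ⟨z, rfl, fun i => ?_⟩⟩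
    obtain ⟨w, hw, hwz⟩ := hz _ hx
    have hwx : f i w = f i x := congrFun hw i
    calc dist (f i x) (f i z) = dist (f i w) (f i z) := by rw [hwx]
      _ ≤ C * d w z := hlip i w z
      _ ≤ (|C| + 1) * d w z := by
        gcongr
        · exact d.nonneg w z
        · linarith [le_abs_self C]
      _ ≤ ε := (le_div_iff₀' hC).1 hwz

theorem exists_subseq_forall_tendsto_of_countable_net {X E : Type*} [PseudoMetricSpace E]
    [ProperSpace E] {f : ℕ → X → E} (hb : ∀ x, Bornology.IsBounded (range fun n => f n x))
    (hnet : ∀ ε > 0, ∃ D : Set X, D.Countable ∧ ∀ x, ∃ y ∈ D, ∀ n, dist (f n x) (f n y) ≤ ε) :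
    ∃ σ : ℕ → ℕ, StrictMono σ ∧ ∀ x, ∃ l, Tendsto (fun n => f (σ n) x) atTop (𝓝 l) := by
  choose D hD hDnet using fun k : ℕ => hnet _ (Nat.one_div_pos_of_nat (n := k) (α := ℝ))
  let S : Set X := ⋃ k, D k
  have : Countable S := (countable_iUnion hD).to_subtype
  obtain ⟨l, -, σ, hσ, hl⟩ :=
    (isCompact_univ_pi fun s : S => (hb s).isCompact_closure).tendsto_subseq
      (x := fun n (s : S) => f n s) fun n s _ => subset_closure (mem_range_self n)
  refine ⟨σ, hσ, fun x => cauchySeq_tendsto_of_complete (Metric.cauchySeq_iff.2 fun ε hε => ?_)⟩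
  obtain ⟨k, hk⟩ := exists_nat_one_div_lt (show 0 < ε / 3 by positivity)
  obtain ⟨y, hy, hxy⟩ := hDnet k x
  have hcauchy : CauchySeq fun n => f (σ n) y :=
    (tendsto_pi_nhds.1 hl ⟨y, mem_iUnion.2 ⟨k, hy⟩⟩).cauchySeq
  obtain ⟨N, hN⟩ := Metric.cauchySeq_iff.1 hcauchy (ε / 3) (by positivity)
  refine ⟨N, fun m hm n hn => ?_⟩
  calc dist (f (σ m) x) (f (σ n) x)
      ≤ dist (f (σ m) x) (f (σ m) y) + dist (f (σ m) y) (f (σ n) y)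
        + dist (f (σ n) y) (f (σ n) x) := dist_triangle4 _ _ _ _
    _ < ε := by linarith [hN m hm n hn, hxy (σ m), hxy (σ n), dist_comm (f (σ n) x) (f (σ n) y)]

theorem FragmentedBy.exists_subseq_forall_tendsto {K : Type*} [TopologicalSpace K]
    [CompactSpace K] {d : PseudoMetric K ℝ} (h : FragmentedBy K d) {f : ℕ → C(K, ℝ)} {M C : ℝ}
    (hM : ∀ n, ‖f n‖ ≤ M) (hlip : ∀ n x y, |f n x - f n y| ≤ C * d x y) :
    ∃ σ : ℕ → ℕ, StrictMono σ ∧ ∀ x, ∃ l, Tendsto (fun n => f (σ n) x) atTop (𝓝 l) := by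
  refine exists_subseq_forall_tendsto_of_countable_net (f := fun n x => f n x) (fun x => ?_)
    fun ε hε => h.exists_countable_net (fun n => (f n).continuous) hlip hε
  refine isBounded_iff_forall_norm_le.2 ⟨M, ?_⟩
  rintro _ ⟨n, rfl⟩
  exact ((f n).norm_coe_le_norm x).trans (hM n)

end CountableNet

section PointwiseNull

open MeasureTheory

variable {K : Type*} [TopologicalSpace K] [CompactSpace K]

theorem exists_positiveLinearMap_le {t : Set C(K, ℝ)} (ht : Convex ℝ t) {ε : ℝ} (hε : 0 < ε)
    (h : ∀ g ∈ t, ∃ x, ε ≤ g x) : ∃ Λ : C(K, ℝ) →ₚ[ℝ] ℝ, ∃ r, 0 < r ∧ ∀ g ∈ t, r ≤ Λ g := by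
  let s : Set C(K, ℝ) := {g | ∀ x, g x < ε}
  have hs : Convex ℝ s := fun f hf g hg α β hα hβ hαβ x => convex_Iio ε (hf x) (hg x) hα hβ hαβ
  have hs' : IsOpen s := by
    simpa [s, MapsTo] using
      ContinuousMap.isOpen_setOfPred_mapsTo (isCompact_univ (X := K)) (isOpen_Iio (a := ε))
  have hdisj : Disjoint s t := Set.disjoint_left.2 fun g hgs hgt =>
    let ⟨x, hx⟩ := h g hgt
    hx.not_gt (hgs x)
  obtain ⟨Λ, r, hΛs, hΛt⟩ := geometric_hahn_banach_open hs hs' ht hdisj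
  have hr : 0 < r := by simpa using hΛs 0 fun x => by simpa using hε
  have hΛ : ∀ g, 0 ≤ g → 0 ≤ Λ g := by
    intro g hg
    by_contra! hneg
    obtain ⟨n, hn⟩ := Archimedean.arch r (neg_pos.2 hneg)
    have hlt : Λ (-(n • g)) < r := hΛs _ fun x => by
      have hnonneg : 0 ≤ (n : ℝ) * g x := mul_nonneg n.cast_nonneg (hg x)
      simpa using (neg_nonpos.2 hnonneg).trans_lt hε
    rw [map_neg, map_nsmul, ← smul_neg] at hlt
    exact hn.not_gt hlt
  exact ⟨PositiveLinearMap.mk₀ Λ.toLinearMap hΛ, r, hr, hΛt⟩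

variable [T2Space K] {h : ℕ → C(K, ℝ)} {M : ℝ} (hM : ∀ n, ‖h n‖ ≤ M)
  (hlim : ∀ x, Tendsto (fun n => h n x) atTop (𝓝 0))
include hM hlim

theorem tendsto_positiveLinearMap_of_pointwise (Λ : C(K, ℝ) →ₚ[ℝ] ℝ) :
    Tendsto (fun n => Λ (h n)) atTop (𝓝 0) := by
  borelize K
  let Φ : CompactlySupportedContinuousMap K ℝ →ₚ[ℝ] ℝ := PositiveLinearMap.mk₀
    { toFun := fun f => Λ f.toContinuousMap
      map_add' := fun f g => map_add Λ f.toContinuousMap g.toContinuousMap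
      map_smul' := fun c f => map_smul Λ c f.toContinuousMap } fun f hf => map_nonneg Λ hf
  let μ := RealRMK.rieszMeasure Φ
  have hμ : ∀ g : C(K, ℝ), ∫ x, g x ∂μ = Λ g := fun g =>
    RealRMK.integral_rieszMeasure Φ (CompactlySupportedContinuousMap.continuousMapEquiv g)
  have : IsFiniteMeasure μ := inferInstanceAs (IsFiniteMeasure (RealRMK.rieszMeasure Φ))
  simpa only [hμ, integral_zero] using tendsto_integral_of_dominated_convergence
    (fun _ => M) (fun n => (h n).continuous.aestronglyMeasurable) (integrable_const M)
    (fun n => ae_of_all μ fun x => ((h n).norm_coe_le_norm x).trans (hM n)) (ae_of_all μ hlim)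

theorem exists_mem_convexHull_norm_lt {ε : ℝ} (hε : 0 < ε) :
    ∃ g ∈ convexHull ℝ (range h), ‖g‖ < ε := by
  by_contra! hfar
  -- Separating the upper closure of `{|g|}`, not the hull itself, makes the functional positive.
  let t : Set C(K, ℝ) := {k | ∃ g ∈ convexHull ℝ (range h), |g| ≤ k}
  have ht : Convex ℝ t := by
    rintro k ⟨f, hf, hfk⟩ l ⟨g, hg, hgl⟩ α β hα hβ hαβ
    refine ⟨α • f + β • g, convex_convexHull ℝ _ hf hg hα hβ hαβ, ?_⟩
    intro x
    calc |α * f x + β * g x| ≤ |α * f x| + |β * g x| := abs_add_le _ _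
      _ = α * |f x| + β * |g x| := by rw [abs_mul, abs_mul, abs_of_nonneg hα, abs_of_nonneg hβ]
      _ ≤ α * k x + β * l x := by
        gcongr
        exacts [hfk x, hgl x]
  obtain ⟨Λ, r, hr, hΛ⟩ := exists_positiveLinearMap_le ht hε fun k ⟨g, hg, hgk⟩ => by
    by_contra! hlt
    exact (hfar g hg).not_gt
      ((ContinuousMap.norm_lt_iff _ hε).2 fun x => (hgk x).trans_lt (hlt x))
  have hlim' : Tendsto (fun n => Λ |h n|) atTop (𝓝 0) :=
    tendsto_positiveLinearMap_of_pointwise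
      (fun n => (ContinuousMap.norm_le _ ((norm_nonneg _).trans (hM n))).2 fun x => by
        simpa using ((h n).norm_coe_le_norm x).trans (hM n))
      (fun x => by simpa using (hlim x).abs) Λ
  exact hr.not_ge (ge_of_tendsto' hlim' fun n =>
    hΛ _ ⟨h n, subset_convexHull ℝ _ (mem_range_self n), le_rfl⟩)

end PointwiseNull

theorem two_le_norm_of_mem_convexHull {ι κ : Type*} [DecidableEq ι] {σ τ : κ → ι}
    (hστ : ∀ i j, σ i ≠ τ j) {w : ℓ¹(ι, ℝ)}
    (hw : w ∈ convexHull ℝ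
      (range fun k => (lp.single 1 (σ k) 1 - lp.single 1 (τ k) 1 : ℓ¹(ι, ℝ)))) :
    2 ≤ ‖w‖ := by
  classical
  let v : ι → ℝ := fun i => if i ∈ range σ then 1 else -1
  have hv : ∀ i, ‖v i‖ ≤ 1 := fun i => by
    simp only [v]
    split_ifs <;> simp
  have hsub : convexHull ℝ
      (range fun k => (lp.single 1 (σ k) 1 - lp.single 1 (τ k) 1 : ℓ¹(ι, ℝ))) ⊆
      ellOneLift v hv ⁻¹' {2} := by
    refine convexHull_min ?_ ((convex_singleton 2).linear_preimage (ellOneLift v hv).toLinearMap)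
    rintro _ ⟨k, rfl⟩
    have hτ : τ k ∉ range σ := fun ⟨i, hi⟩ => hστ i k hi
    simp only [mem_preimage, map_sub, ellOneLift_single, v, hτ, mem_range_self, if_true, if_false]
    norm_num
  calc (2 : ℝ) = ‖ellOneLift v hv w‖ := by rw [show ellOneLift v hv w = 2 from hsub hw]; simp
    _ ≤ ‖w‖ := norm_ellOneLift_le hv w

section Fragmented

variable {K : Type*} [TopologicalSpace K] [CompactSpace K] [T2Space K] {d : PseudoMetric K ℝ}

theorem FragmentedBy.not_antilipschitz (h : FragmentedBy K d) (T : ℓ¹(ℕ, ℝ) →L[ℝ] C(K, ℝ))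
    (hT : ∀ a, IsLipschitzFor d (T a)) (c : ℝ≥0) : ¬ AntilipschitzWith c T := by
  intro hc
  obtain ⟨C, hC⟩ := exists_norm_sub_le_of_pointwise_lipschitz d
    (fun x => (ContinuousMap.evalCLM ℝ x).comp T) hT
  let b : ℕ → ℓ¹(ℕ, ℝ) := fun n => lp.single 1 n 1
  have hb : ∀ n, ‖b n‖ = 1 := fun n => by simp [b, lp.norm_single]
  obtain ⟨σ, hσ, hlim⟩ := h.exists_subseq_forall_tendsto (f := fun n => T (b n)) (M := ‖T‖)
    (fun n => by simpa [hb] using T.le_opNorm (b n)) fun n x y => by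
      simpa [hb] using ContinuousLinearMap.le_of_opNorm_le _ (hC x y) (b n)
  let u : ℕ → ℓ¹(ℕ, ℝ) := fun k => b (σ (2 * k)) - b (σ (2 * k + 1))
  have hM : ∀ k, ‖T (u k)‖ ≤ ‖T‖ * 2 := fun k => by
    refine T.le_opNorm_of_le ((norm_sub_le _ _).trans_eq ?_)
    rw [hb, hb, one_add_one_eq_two]
  have hnull : ∀ x, Tendsto (fun k => T (u k) x) atTop (𝓝 0) := fun x => by
    obtain ⟨l, hl⟩ := hlim x
    have heven : Tendsto (fun k : ℕ => 2 * k) atTop atTop := tendsto_id.const_mul_atTop' two_pos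
    have hodd : Tendsto (fun k : ℕ => 2 * k + 1) atTop atTop :=
      tendsto_atTop_mono (fun k => Nat.le_succ _) heven
    simpa [u] using (hl.comp heven).sub (hl.comp hodd)
  have hε : 0 < 2 / ((c : ℝ) + 1) := by positivity
  obtain ⟨g, hg, hgε⟩ := exists_mem_convexHull_norm_lt hM hnull hε
  obtain ⟨w, hw, rfl⟩ : g ∈ T '' convexHull ℝ (range u) := by
    rwa [← ContinuousLinearMap.coe_coe, LinearMap.image_convexHull, ← range_comp]
  have hw2 : 2 ≤ ‖w‖ := two_le_norm_of_mem_convexHull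
    (fun i j hij => by have := hσ.injective hij; omega) hw
  have hwT : ‖w‖ ≤ c * ‖T w‖ := ZeroHomClass.bound_of_antilipschitz T hc w
  rw [lt_div_iff₀ (by positivity)] at hgε
  linarith [norm_nonneg (T w)]

theorem not_fragmentedBy_of_containsIsomorphicLipschitzCopy
    (h : ContainsIsomorphicLipschitzCopy K d ℓ¹(ℕ, ℝ)) : ¬ FragmentedBy K d := by
  intro hfrag
  obtain ⟨X, hX, ⟨e⟩⟩ := h
  let T : ℓ¹(ℕ, ℝ) →L[ℝ] C(K, ℝ) := X.subtypeL.comp (e : ℓ¹(ℕ, ℝ) →L[ℝ] X)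
  obtain ⟨c, hc⟩ := T.antilipschitz_of_isEmbedding
    (IsEmbedding.subtypeVal.comp e.toHomeomorph.isEmbedding)
  exact hfrag.not_antilipschitz T (fun a => hX _ (e a).2) c hc

end Fragmented

theorem theorem5p5_general {K : Type*} [TopologicalSpace K] [CompactSpace K] [T2Space K]
    (d : PseudoMetric K ℝ) (hlsc : LowerSemicontinuous (fun p : K × K => d p.1 p.2)) :
    List.TFAE
      [¬ FragmentedBy K d,
        ContainsIsometricLipschitzCopy K d EllOne,
        ContainsIsomorphicLipschitzCopy K d EllOne] := by
  tfae_have 1 → 2 := containsIsometricLipschitzCopy_of_not_fragmentedBy hlsc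
  tfae_have 2 → 3 := fun ⟨X, hX, ⟨e⟩⟩ => ⟨X, hX, ⟨e.toContinuousLinearEquiv⟩⟩
  tfae_have 3 → 1 := not_fragmentedBy_of_containsIsomorphicLipschitzCopy
  tfae_finish

theorem theorem5p5 {K : Type*} [TopologicalSpace K] [CompactSpace K] [T2Space K]
    (d : K → K → ℝ) (hd : IsMetricOn d)
    (hlsc : LowerSemicontinuous (fun p : K × K => d p.1 p.2)) :
    List.TFAE
      [¬ FragmentedBy K d,
        ContainsIsometricLipschitzCopy K d EllOne,
        ContainsIsomorphicLipschitzCopy K d EllOne] :=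
  theorem5p5_general ⟨d, fun x => (hd.eq_zero_iff x x).2 rfl, hd.symm, hd.triangle⟩ hlsc
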